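/- Let $T_0>0$ and $\sigma>0$. Let $a\in H^2(0,1)$ (identified with its continuous representative on $[0,1]$) satisfy $\frac1\Lambda\le a(x)\le\Lambda$ for all $x\in(0,1)$, for some constant $\Lambda\ge 1$. For $\tau>0$ put $Q_\tau:=(0,1)\times(0,\tau)$. Let $\widetilde f$ be a measurable function, integrable on $Q_\tau$ for every $\tau\in(0,T_0)$, and let $d_0,d_1\in C([0,+\infty))$. Consider $$\widetilde w_t=(a\,\widetilde w_x)_x-\sigma\widetilde w+\widetilde f\ \text{ in } Q_{T_0},\qquad \widetilde w(0,t)=d_0(t),\quad \widetilde w(1,t)=d_1(t)\ \ (0<t<T_0),\qquad \widetilde w(x,0)=0\ \ (0<x<1).$$ A (weak) solution is a function $\widetilde w\in C([0,T_0);L^2(0,1))$ with $\widetilde w[0]=0$, where $\widetilde w[t]:=\widetilde w(\cdot,t)$, such that for every $t\in[0,T_0)$ and every $\varphi\in C^2([0,1])$ with $\varphi(0)=\varphi(1)=0$, $$\int_0^1\widetilde w(x,t)\varphi(x)\,dx=\int_0^t\!\!\int_0^1\widetilde w\,\big((a\varphi')'-\sigma\varphi\big)\,dx\,ds+\int_{Q_t}\widetilde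 f\,\varphi\,dx\,ds+\int_0^t\big(a(0)\varphi'(0)d_0(s)-a(1)\varphi'(1)d_1(s)\big)\,ds .$$ Then every such solution satisfies, for all $t\in(0,T_0)$, $$\|\widetilde w[t]\|_{L^\infty(0,1)}\le\frac1\sigma\|\widetilde f\|_{L^\infty(Q_t)}+\|d_0\|_{L^\infty(0,t)}+\|d_1\|_{L^\infty(0,t)},$$ where the norms take values in $[0,+\infty]$; in particular, $\widetilde w[t]\in L^\infty(0,1)$ whenever the right-hand side is finite. -/

import Mathlib

open MeasureTheory Set
open scoped ENNReal ContDiff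

namespace TargetSystem

/-- The unit interval `(0,1)` with Lebesgue measure. -/
noncomputable abbrev μ : Measure ℝ := (volume : Measure ℝ).restrict (Ioo 0 1)

/-- The space `L²(0,1)`. -/
abbrev L2 : Type := Lp ℝ 2 μ

/-- The space-time cylinder `Q_τ = (0,1) × (0,τ)`; points are written `(x, t)`. -/
def Q (τ : ℝ) : Set (ℝ × ℝ) := Ioo (0 : ℝ) 1 ×ˢ Ioo (0 : ℝ) τ

/-- `v` is a weak derivative of `u` on `(0,1)`:
`∫ u φ' = - ∫ v φ` for every smooth `φ` with compact support in `(0,1)`. -/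
def IsWeakDeriv (u v : ℝ → ℝ) : Prop :=
  ∀ φ : ℝ → ℝ, ContDiff ℝ ∞ φ → HasCompactSupport φ → tsupport φ ⊆ Ioo 0 1 →
    ∫ x in Ioo (0 : ℝ) 1, u x * deriv φ x = - ∫ x in Ioo (0 : ℝ) 1, v x * φ x

/-- Membership in the Sobolev space `H²(0,1)`: the function and its first two weak derivatives
are in `L²(0,1)`. -/
def MemH2 (u : ℝ → ℝ) : Prop :=
  ∃ u₁ u₂ : ℝ → ℝ, IsWeakDeriv u u₁ ∧ IsWeakDeriv u₁ u₂ ∧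
    MemLp u 2 μ ∧ MemLp u₁ 2 μ ∧ MemLp u₂ 2 μ

/-- `w` is a (weak) solution in `C([0,T₀); L²(0,1))` of
`w_t = (a w_x)_x - σ w + f` in `(0,1) × (0,T₀)`, `w(0,t) = d₀(t)`, `w(1,t) = d₁(t)`, `w(x,0) = 0`.

The test functions are the `C²` functions on `[0,1]` (restrictions of `C²` functions on `ℝ`) that
vanish at both end points. Two integrations by parts in `x` turn `∫ (a w_x)_x φ` into
`∫ w (a φ')' + a(0) φ'(0) d₀ - a(1) φ'(1) d₁`, which is meaningful for `w` merely in `L²` and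
carries the boundary conditions. -/
structure IsWeakSolution (a : ℝ → ℝ) (σ T₀ : ℝ) (f : ℝ × ℝ → ℝ) (d₀ d₁ : ℝ → ℝ) (w : ℝ → L2) :
    Prop where
  continuousOn : ContinuousOn w (Ico 0 T₀)
  initial : w 0 = 0
  weak_eq : ∀ φ : ℝ → ℝ, ContDiff ℝ 2 φ → φ 0 = 0 → φ 1 = 0 → ∀ t ∈ Ico 0 T₀,
    ∫ x in Ioo (0 : ℝ) 1, w t x * φ x =
      (∫ s in (0 : ℝ)..t, ∫ x in Ioo (0 : ℝ) 1,
          w s x * (deriv (fun y => a y * deriv φ y) x - σ * φ x))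
        + (∫ p in Q t, f p * φ p.1)
        + ∫ s in (0 : ℝ)..t, (a 0 * deriv φ 0 * d₀ s - a 1 * deriv φ 1 * d₁ s)

end TargetSystem

/-! The proof is by duality. Write `ℓφ = (a φ')' - σ φ` and let `k` be the right-hand side of the
estimate, supposed finite. It suffices that `v = w - k` satisfies `⟨v(T), g⟩ ≤ 0` for all smooth `g
≥ 0` compactly supported in (0,1), and to apply this to `w` and to `-w`.

Since `f ≤ σ k`, `d₀ ≤ k` and `d₁ ≤ k`, the weak equation tested with `φ ≥ 0` vanishing at 0 and 1
gives `⟨v(t), φ⟩ ≤ ⟨v(s), φ⟩ + ∫ ⟨v, ℓφ⟩` over [s,t] (`evolution_le`). As `w` is only in L² in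
space, `v⁺` is not an admissible test function. Instead `g` is propagated backwards by implicit
Euler steps `φₘ₊₁ - h ℓφₘ₊₁ = φₘ`, `φ₀ = g` (`pairing_nonpos_of_evolution_le`). The elliptic maximum
principle (`le_of_forall_le`) keeps `φₘ ≥ 0` and `|ℓφₘ| ≤ L` with `L` independent of `m` and `h`.
Each step costs at most `h L ε`, where `ε` bounds the oscillation of `v` in L² over time `h`.
Summing, `⟨v(T), g⟩ ≤ ⟨v(0), φₙ⟩ + T L ε ≤ T L ε`, because `v(0) = -k ≤ 0`; then `ε → 0`.

The elliptic problems are solved by shooting (`exists_isFluxPair_boundary`). An H² coefficient is C¹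
on [0,1] (`exists_contDiff_extension`), so their solutions are C² and hence admissible in the weak
formulation. -/

open Filter Topology

/-! ### Elliptic maximum principle in flux form -/

/-- `φ' = r p` and `p' = q` on the line with `q` continuous. For `r = 1 / a` this says that
`p = a φ'` and `q = (a φ')'`. -/
structure IsFluxPair (r φ p q : ℝ → ℝ) : Prop where
  hasDerivAt_fst : ∀ x, HasDerivAt φ (r x * p x) x
  hasDerivAt_snd : ∀ x, HasDerivAt p (q x) x
  continuous_deriv : Continuous q

namespace IsFluxPair

variable {r φ p q φ' p' q' : ℝ → ℝ}

lemma continuous_fst (h : IsFluxPair r φ p q) : Continuous φ :=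
  continuous_iff_continuousAt.2 fun x => (h.hasDerivAt_fst x).continuousAt

lemma continuous_snd (h : IsFluxPair r φ p q) : Continuous p :=
  continuous_iff_continuousAt.2 fun x => (h.hasDerivAt_snd x).continuousAt

lemma neg (h : IsFluxPair r φ p q) :
    IsFluxPair r (fun x => -φ x) (fun x => -p x) (fun x => -q x) where
  hasDerivAt_fst x := (h.hasDerivAt_fst x).neg.congr_deriv (by ring)
  hasDerivAt_snd x := (h.hasDerivAt_snd x).neg
  continuous_deriv := h.continuous_deriv.neg

lemma sub_const_mul (h : IsFluxPair r φ p q) (h' : IsFluxPair r φ' p' q') (θ : ℝ) :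
    IsFluxPair r (fun x => φ x - θ * φ' x) (fun x => p x - θ * p' x)
      (fun x => q x - θ * q' x) where
  hasDerivAt_fst x :=
    ((h.hasDerivAt_fst x).sub ((h'.hasDerivAt_fst x).const_mul θ)).congr_deriv (by ring)
  hasDerivAt_snd x := (h.hasDerivAt_snd x).sub ((h'.hasDerivAt_snd x).const_mul θ)
  continuous_deriv := h.continuous_deriv.sub (h'.continuous_deriv.const_smul θ)

lemma contDiff_two (h : IsFluxPair r φ p q) (hr : ContDiff ℝ 1 r) : ContDiff ℝ 2 φ := by
  have hp : ContDiff ℝ 1 p := by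
    rw [contDiff_one_iff_deriv]
    refine ⟨fun x => (h.hasDerivAt_snd x).differentiableAt, ?_⟩
    rw [show deriv p = q from funext fun x => (h.hasDerivAt_snd x).deriv]
    exact h.continuous_deriv
  rw [show (2 : WithTop ℕ∞) = 1 + 1 by norm_num, contDiff_succ_iff_deriv]
  refine ⟨fun x => (h.hasDerivAt_fst x).differentiableAt, by simp, ?_⟩
  rw [show deriv φ = fun x => r x * p x from funext fun x => (h.hasDerivAt_fst x).deriv]
  exact hr.mul hp

/-- Weak maximum principle for `c φ - (a φ')' ≤ c M` with zero boundary values. -/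
lemma le_of_forall_le (h : IsFluxPair r φ p q) (hr : ∀ x ∈ Icc (0 : ℝ) 1, 0 < r x)
    (h0 : φ 0 = 0) (h1 : φ 1 = 0) {c M : ℝ} (hc : 0 < c) (hM : 0 ≤ M)
    (hq : ∀ x ∈ Ioo (0 : ℝ) 1, c * φ x - q x ≤ c * M) :
    ∀ x ∈ Icc (0 : ℝ) 1, φ x ≤ M := by
  by_contra! hcon
  obtain ⟨y, hy, hyM⟩ := hcon
  obtain ⟨x, hx, hmax⟩ := isCompact_Icc.exists_isMaxOn (nonempty_Icc.2 zero_le_one)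
    h.continuous_fst.continuousOn
  have hxM : M < φ x := hyM.trans_le (hmax hy)
  have hx0 : 0 < x := hx.1.lt_of_ne (by rintro rfl; linarith)
  have hx1 : x < 1 := hx.2.lt_of_ne (by rintro rfl; linarith)
  have hqx : 0 < q x := by
    have := hq x ⟨hx0, hx1⟩
    nlinarith
  have hloc : IsLocalMax φ x := hmax.isLocalMax (Icc_mem_nhds hx0 hx1)
  have hpx : p x = 0 := by
    have := hloc.hasDerivAt_eq_zero (h.hasDerivAt_fst x)
    exact (mul_eq_zero.1 this).resolve_left (hr x hx).ne'
  -- At a maximum above `M` the flux vanishes and has positive derivative, so just to the right it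
  -- is positive and `φ` increases, a contradiction. No second derivative of `φ` is needed.
  have hev : ∀ᶠ z in 𝓝[>] x, p x < p z := by
    have := (h.hasDerivAt_snd x).hasDerivWithinAt (s := Ioi x)
    have h2 := (hasDerivWithinAt_iff_tendsto_slope' (by simp)).1 this
    filter_upwards [h2.eventually (lt_mem_nhds hqx), self_mem_nhdsWithin] with z hz hxz
    rw [slope_def_field] at hz
    have hxz' : 0 < z - x := sub_pos.2 hxz
    have := (div_pos_iff_of_pos_right hxz').1 hz
    linarith
  obtain ⟨u, hu, hup⟩ := mem_nhdsGT_iff_exists_Ioo_subset.1 hev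
  -- The cut at 1 keeps the interval where `r > 0` and where `x` is a maximum.
  have hxu : x < min u 1 := lt_min hu hx1
  have hmono : StrictMonoOn φ (Icc x (min u 1)) := by
    refine strictMonoOn_of_deriv_pos (convex_Icc _ _) h.continuous_fst.continuousOn ?_
    intro z hz
    rw [interior_Icc] at hz
    rw [(h.hasDerivAt_fst z).deriv]
    have h3 : p x < p z := hup ⟨hz.1, hz.2.trans_le (min_le_left _ _)⟩
    exact mul_pos (hr z ⟨hx.1.trans hz.1.le, hz.2.le.trans (min_le_right _ _)⟩) (hpx ▸ h3)
  have h4 := hmono (left_mem_Icc.2 hxu.le) (right_mem_Icc.2 hxu.le) hxu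
  have h5 : φ (min u 1) ≤ φ x := hmax ⟨hx.1.trans hxu.le, min_le_right _ _⟩
  linarith

lemma abs_le_of_forall_abs_le (h : IsFluxPair r φ p q) (hr : ∀ x ∈ Icc (0 : ℝ) 1, 0 < r x)
    (h0 : φ 0 = 0) (h1 : φ 1 = 0) {c M : ℝ} (hc : 0 < c) (hM : 0 ≤ M)
    (hq : ∀ x ∈ Ioo (0 : ℝ) 1, |c * φ x - q x| ≤ c * M) :
    ∀ x ∈ Icc (0 : ℝ) 1, |φ x| ≤ M := by
  intro x hx
  refine abs_le.2 ⟨?_, h.le_of_forall_le hr h0 h1 hc hM (fun y hy => (abs_le.1 (hq y hy)).2) x hx⟩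
  have := h.neg.le_of_forall_le hr (by simpa using h0) (by simpa using h1) hc hM
    (fun y hy => by linarith [(abs_le.1 (hq y hy)).1]) x hx
  linarith

end IsFluxPair

/-! ### Solvability of the elliptic boundary value problem -/

lemma abs_integral_le_of_abs_le_exp {g : ℝ → ℝ} {C L x : ℝ} (hL : 0 < L) (hC : 0 ≤ C)
    (hx : 0 ≤ x) (hg : ∀ z ∈ Icc 0 x, |g z| ≤ C * Real.exp (L * z)) :
    |∫ z in (0 : ℝ)..x, g z| ≤ C / L * Real.exp (L * x) := by
  have hd : ∀ z : ℝ, HasDerivAt (fun z => C / L * Real.exp (L * z)) (C * Real.exp (L * z)) z := by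
    intro z
    exact ((((hasDerivAt_id' z).const_mul L).exp).const_mul (C / L)).congr_deriv
      (by field_simp)
  have hcont : Continuous fun z => C * Real.exp (L * z) := by fun_prop
  have h1 : ‖∫ z in (0 : ℝ)..x, g z‖ ≤ ∫ z in (0 : ℝ)..x, C * Real.exp (L * z) :=
    intervalIntegral.norm_integral_le_of_norm_le hx
      (ae_of_all _ fun z hz => hg z ⟨hz.1.le, hz.2⟩) (hcont.intervalIntegrable _ _)
  rw [intervalIntegral.integral_eq_sub_of_hasDerivAt (fun z _ => hd z)
    (hcont.intervalIntegrable _ _)] at h1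
  have h2 : 0 ≤ C / L * Real.exp (L * 0) := by positivity
  rw [Real.norm_eq_abs] at h1
  linarith

/-- Banach's fixed point theorem for the twice integrated equation, with unknown `u = exp (-L x) φ`
in C([0,1]). The exponential weight gains a factor `1 / L` per integration, so the map contracts on
all of [0,1] at once. -/
lemma exists_isFluxPair_initial {r G : ℝ → ℝ} (hr : Continuous r) (hG : Continuous G) (c α : ℝ) :
    ∃ φ p q, IsFluxPair r φ p q ∧ φ 0 = 0 ∧ p 0 = α ∧
      ∀ x ∈ Icc (0 : ℝ) 1, q x = c * φ x - G x := by
  obtain ⟨R, hR⟩ := isCompact_Icc.exists_bound_of_continuousOn (s := Icc (0 : ℝ) 1) hr.continuousOn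
  have hR0 : 0 ≤ R := (norm_nonneg _).trans (hR 0 (by simp))
  -- Large enough that the Lipschitz constant `R * |c| / L ^ 2` is at most `1 / 2`.
  set L : ℝ := 2 * (R * |c|) + 1 with hLdef
  have hRc : 0 ≤ R * |c| := by positivity
  have hL : 0 < L := by positivity
  have hI : (0 : ℝ) ≤ 1 := zero_le_one
  let ext : C(Icc (0 : ℝ) 1, ℝ) → ℝ → ℝ := fun u => IccExtend hI u
  have hext : ∀ u, Continuous (ext u) := fun u => u.continuous.Icc_extend'
  have hextdist : ∀ u v z, |ext u z - ext v z| ≤ dist u v := fun u v z => by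
    rw [← Real.dist_eq]; exact ContinuousMap.dist_apply_le_dist _
  let Q : C(Icc (0 : ℝ) 1, ℝ) → ℝ → ℝ := fun u z => c * (Real.exp (L * z) * ext u z) - G z
  have hQ : ∀ u, Continuous (Q u) := fun u => by
    have := hext u
    fun_prop
  let P : C(Icc (0 : ℝ) 1, ℝ) → ℝ → ℝ := fun u y => α + ∫ z in (0 : ℝ)..y, Q u z
  have hPd : ∀ u x, HasDerivAt (P u) (Q u x) x := fun u x =>
    ((hQ u).integral_hasStrictDerivAt 0 x).hasDerivAt.const_add α
  have hP : ∀ u, Continuous (P u) := fun u =>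
    continuous_iff_continuousAt.2 fun x => (hPd u x).continuousAt
  have hrP : ∀ u, Continuous fun y => r y * P u y := fun u => hr.mul (hP u)
  let Φ : C(Icc (0 : ℝ) 1, ℝ) → ℝ → ℝ := fun u x => ∫ y in (0 : ℝ)..x, r y * P u y
  have hΦd : ∀ u x, HasDerivAt (Φ u) (r x * P u x) x := fun u x =>
    ((hrP u).integral_hasStrictDerivAt 0 x).hasDerivAt
  have hΦ : ∀ u, Continuous (Φ u) := fun u =>
    continuous_iff_continuousAt.2 fun x => (hΦd u x).continuousAt
  let S : C(Icc (0 : ℝ) 1, ℝ) → C(Icc (0 : ℝ) 1, ℝ) := fun u =>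
    ⟨fun x => Real.exp (-(L * x)) * Φ u x, by have := hΦ u; fun_prop⟩
  have hPdiff : ∀ u v, ∀ y ∈ Icc (0 : ℝ) 1,
      |P u y - P v y| ≤ |c| * dist u v / L * Real.exp (L * y) := by
    intro u v y hy
    have : P u y - P v y = ∫ z in (0 : ℝ)..y, (Q u z - Q v z) := by
      rw [intervalIntegral.integral_sub ((hQ u).intervalIntegrable _ _)
        ((hQ v).intervalIntegrable _ _)]
      simp only [P]; ring
    rw [this]
    refine abs_integral_le_of_abs_le_exp hL (by positivity) hy.1 fun z _ => ?_
    have : Q u z - Q v z = c * (Real.exp (L * z) * (ext u z - ext v z)) := by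
      simp only [Q]; ring
    rw [this, abs_mul, abs_mul, abs_of_pos (Real.exp_pos _)]
    have := mul_le_mul_of_nonneg_left (hextdist u v z)
      (mul_nonneg (abs_nonneg c) (Real.exp_pos (L * z)).le)
    linarith
  have hΦdiff : ∀ u v, ∀ x ∈ Icc (0 : ℝ) 1,
      |Φ u x - Φ v x| ≤ R * (|c| * dist u v / L) / L * Real.exp (L * x) := by
    intro u v x hx
    have : Φ u x - Φ v x = ∫ y in (0 : ℝ)..x, (r y * P u y - r y * P v y) := by
      rw [intervalIntegral.integral_sub ((hrP u).intervalIntegrable _ _)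
        ((hrP v).intervalIntegrable _ _)]
    rw [this]
    refine abs_integral_le_of_abs_le_exp hL (by positivity) hx.1 fun y hy => ?_
    have hy' : y ∈ Icc (0 : ℝ) 1 := ⟨hy.1, hy.2.trans hx.2⟩
    rw [← mul_sub, abs_mul, mul_assoc]
    exact mul_le_mul (hR y hy') (hPdiff u v y hy') (abs_nonneg _) hR0
  have hS : ContractingWith (1 / 2) S := by
    refine ⟨by norm_num, LipschitzWith.of_dist_le_mul fun u v => ?_⟩
    refine (ContinuousMap.dist_le (by positivity)).2 fun x => ?_
    have h1 := hΦdiff u v x x.2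
    have h2 : dist (S u x) (S v x) = Real.exp (-(L * x)) * |Φ u x - Φ v x| := by
      rw [Real.dist_eq]
      change |Real.exp (-(L * x)) * Φ u x - Real.exp (-(L * x)) * Φ v x| = _
      rw [← mul_sub, abs_mul, abs_of_pos (Real.exp_pos _)]
    rw [h2]
    have h3 := mul_le_mul_of_nonneg_left h1 (Real.exp_pos (-(L * x))).le
    refine h3.trans ?_
    have h4 : Real.exp (-(L * x)) * (R * (|c| * dist u v / L) / L * Real.exp (L * x))
        = R * |c| / (L * L) * dist u v * (Real.exp (-(L * x)) * Real.exp (L * x)) := by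
      field_simp
    rw [h4, ← Real.exp_add, neg_add_cancel, Real.exp_zero, mul_one]
    refine mul_le_mul_of_nonneg_right ?_ dist_nonneg
    rw [div_le_iff₀ (by positivity)]
    push_cast
    nlinarith
  obtain ⟨u, hu⟩ : ∃ u, S u = u := ⟨hS.fixedPoint S, hS.fixedPoint_isFixedPt⟩
  refine ⟨Φ u, P u, Q u, ⟨hΦd u, hPd u, hQ u⟩, by simp [Φ], by simp [P], fun x hx => ?_⟩
  have h1 : ext u x = Real.exp (-(L * x)) * Φ u x := by
    have : ext u x = u ⟨x, hx⟩ := IccExtend_of_mem hI u hx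
    rw [this, ← hu]
    simp only [hu]
    exact (congrArg (fun v : C(Icc (0 : ℝ) 1, ℝ) => v ⟨x, hx⟩) hu).symm
  simp only [Q, h1]
  rw [← mul_assoc (Real.exp _), ← Real.exp_add, add_neg_cancel, Real.exp_zero, one_mul]

/-- Solvability of `c φ - (a φ')' = G`, `φ(0) = φ(1) = 0`. -/
lemma exists_isFluxPair_boundary {r G : ℝ → ℝ} (hr : Continuous r) (hG : Continuous G)
    (hrpos : ∀ x ∈ Icc (0 : ℝ) 1, 0 < r x) {c : ℝ} (hc : 0 < c) :
    ∃ φ p q, IsFluxPair r φ p q ∧ φ 0 = 0 ∧ φ 1 = 0 ∧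
      ∀ x ∈ Icc (0 : ℝ) 1, q x = c * φ x - G x := by
  -- Shooting: correct a particular solution by a multiple of the homogeneous one with unit initial
  -- flux.
  obtain ⟨φ₁, p₁, q₁, h₁, h₁0, h₁p, h₁q⟩ :=
    exists_isFluxPair_initial hr (continuous_const (y := (0 : ℝ))) c 1
  obtain ⟨φ₂, p₂, q₂, h₂, h₂0, -, h₂q⟩ := exists_isFluxPair_initial hr hG c 0
  -- Otherwise the maximum principle with `M = 0` gives `φ₁ = 0` on [0,1], so its flux vanishes,
  -- contradicting `p₁ 0 = 1`.
  have hne : φ₁ 1 ≠ 0 := by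
    intro h
    have hz := h₁.abs_le_of_forall_abs_le hrpos h₁0 h hc le_rfl
      (fun x hx => by rw [h₁q x ⟨hx.1.le, hx.2.le⟩]; simp)
    have hp0 : ∀ x ∈ Ioo (0 : ℝ) 1, p₁ x = 0 := by
      intro x hx
      have hev : φ₁ =ᶠ[𝓝 x] fun _ => 0 := by
        filter_upwards [Icc_mem_nhds hx.1 hx.2] with y hy
        exact abs_nonpos_iff.1 (hz y hy)
      have := (h₁.hasDerivAt_fst x).unique ((hasDerivAt_const x (0 : ℝ)).congr_of_eventuallyEq hev)
      exact (mul_eq_zero.1 this).resolve_left (hrpos x ⟨hx.1.le, hx.2.le⟩).ne'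
    have : EqOn p₁ (fun _ => 0) (closure (Ioo 0 1)) :=
      EqOn.closure hp0 h₁.continuous_snd continuous_const
    rw [closure_Ioo zero_ne_one] at this
    have := this (left_mem_Icc.2 zero_le_one)
    simp [h₁p] at this
  refine ⟨_, _, _, h₂.sub_const_mul h₁ (φ₂ 1 / φ₁ 1), by simp [h₁0, h₂0], by field_simp; simp, ?_⟩
  intro x hx
  simp only [h₁q x hx, h₂q x hx]
  ring

/-! ### Sobolev regularity of the coefficient -/

lemma eq_zero_of_tsupport_subset_Ioo {φ : ℝ → ℝ} (h : tsupport φ ⊆ Ioo 0 1) {x : ℝ}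
    (hx : x ∉ Ioo (0 : ℝ) 1) : φ x = 0 :=
  image_eq_zero_of_notMem_tsupport fun hx' => hx (h hx')

lemma integral_primitive_mul_deriv {v φ : ℝ → ℝ} (hv : IntegrableOn v (Ioo 0 1))
    (hφ : ContDiff ℝ ∞ φ) (hsupp : tsupport φ ⊆ Ioo 0 1) :
    ∫ x in Ioo (0 : ℝ) 1, (∫ y in (0 : ℝ)..x, v y) * deriv φ x
      = - ∫ x in Ioo (0 : ℝ) 1, v x * φ x := by
  have hvi : IntervalIntegrable v volume 0 1 :=
    (intervalIntegrable_iff_integrableOn_Ioo_of_le zero_le_one).2 hv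
  have hVac := hvi.absolutelyContinuousOnInterval_intervalIntegral (c := 0) (by simp)
  have hφac : AbsolutelyContinuousOnInterval φ 0 1 :=
    (hφ.of_le (by norm_cast)).contDiffOn.absolutelyContinuousOnInterval
  have h := hVac.integral_mul_deriv_eq_deriv_mul hφac
  rw [eq_zero_of_tsupport_subset_Ioo hsupp (x := 0) (by simp),
    eq_zero_of_tsupport_subset_Ioo hsupp (x := 1) (by simp)] at h
  have h2 : ∫ x in (0 : ℝ)..1, deriv (fun x => ∫ y in (0 : ℝ)..x, v y) x * φ x
      = ∫ x in (0 : ℝ)..1, v x * φ x := by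
    refine intervalIntegral.integral_congr_ae ?_
    filter_upwards [hvi.ae_hasDerivAt_integral] with x hx hx'
    rw [(hx (uIoc_subset_uIcc hx') 0 (by simp)).deriv]
  rw [h2] at h
  simp only [intervalIntegral.integral_of_le zero_le_one, integral_Ioc_eq_integral_Ioo] at h
  linarith

/-- A smooth function with compact support in `(0,1)` and integral zero is the derivative of such a
function. -/
lemma exists_primitive_of_integral_eq_zero {ψ : ℝ → ℝ} (hψ : ContDiff ℝ ∞ ψ)
    (hc : HasCompactSupport ψ) (hs : tsupport ψ ⊆ Ioo 0 1) (h0 : ∫ x, ψ x = 0) :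
    ∃ φ : ℝ → ℝ, ContDiff ℝ ∞ φ ∧ HasCompactSupport φ ∧ tsupport φ ⊆ Ioo 0 1 ∧ deriv φ = ψ := by
  obtain ⟨α, β, hα, hβ, hK⟩ : ∃ α β : ℝ, 0 < α ∧ β < 1 ∧ tsupport ψ ⊆ Icc α β := by
    rcases (tsupport ψ).eq_empty_or_nonempty with he | hne
    -- For empty support, `α > β` makes `Icc α β` empty.
    · exact ⟨1, 0, one_pos, one_pos, by simp [he]⟩
    · have hcK : IsCompact (tsupport ψ) := hc
      exact ⟨sInf (tsupport ψ), sSup (tsupport ψ), (hs (hcK.sInf_mem hne)).1,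
        (hs (hcK.sSup_mem hne)).2, fun x hx => ⟨csInf_le hcK.bddBelow hx, le_csSup hcK.bddAbove hx⟩⟩
  have hz : ∀ x, x ∉ Icc α β → ψ x = 0 := fun x hx =>
    image_eq_zero_of_notMem_tsupport fun hx' => hx (hK hx')
  have hint : Integrable ψ := hψ.continuous.integrable_of_hasCompactSupport hc
  set φ : ℝ → ℝ := fun x => ∫ y in Iic x, ψ y with hφ
  have hφeq : ∀ x, φ x = φ 0 + ∫ y in (0 : ℝ)..x, ψ y := fun x => by
    rw [← intervalIntegral.integral_Iic_sub_Iic hint.integrableOn hint.integrableOn]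
    simp only [hφ]; ring
  have hd : ∀ x, HasDerivAt φ (ψ x) x := fun x => by
    rw [show φ = fun x => φ 0 + ∫ y in (0 : ℝ)..x, ψ y from funext hφeq]
    exact (hψ.continuous.integral_hasStrictDerivAt 0 x).hasDerivAt.const_add _
  have hderiv : deriv φ = ψ := funext fun x => (hd x).deriv
  have hφz : ∀ x, x ∉ Icc α β → φ x = 0 := by
    intro x hx
    rw [mem_Icc, not_and_or, not_le, not_le] at hx
    rcases hx with hx | hx
    · refine setIntegral_eq_zero_of_forall_eq_zero fun y hy => hz y fun hy' => ?_
      exact absurd (hy'.1.trans (mem_Iic.1 hy)) (not_le.2 hx)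
    · rw [← h0]
      refine setIntegral_eq_integral_of_forall_compl_eq_zero fun y hy => hz y fun hy' => hy ?_
      exact hy'.2.trans hx.le
  have hts : tsupport φ ⊆ Icc α β :=
    closure_minimal (fun x hx => by by_contra h; exact hx (hφz x h)) isClosed_Icc
  refine ⟨φ, ?_, isCompact_Icc.of_isClosed_subset (isClosed_tsupport _) hts,
    hts.trans fun x hx => ⟨hα.trans_le hx.1, hx.2.trans_lt hβ⟩, hderiv⟩
  rw [contDiff_infty_iff_deriv]
  exact ⟨fun x => (hd x).differentiableAt, hderiv ▸ hψ⟩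

/-- A function with integrable weak derivative is a.e. a primitive of it. -/
lemma TargetSystem.IsWeakDeriv.ae_eq_primitive {u v : ℝ → ℝ} (h : IsWeakDeriv u v)
    (hu : IntegrableOn u (Ioo 0 1)) (hv : IntegrableOn v (Ioo 0 1)) :
    ∃ C, ∀ᵐ x, x ∈ Ioo (0 : ℝ) 1 → u x = C + ∫ y in (0 : ℝ)..x, v y := by
  have hvi : IntervalIntegrable v volume 0 1 :=
    (intervalIntegrable_iff_integrableOn_Ioo_of_le zero_le_one).2 hv
  set V : ℝ → ℝ := fun x => ∫ y in (0 : ℝ)..x, v y with hV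
  have hVc : ContinuousOn V (Icc 0 1) := by
    have := (hvi.absolutelyContinuousOnInterval_intervalIntegral (c := 0) (by simp)).continuousOn
    rwa [uIcc_of_le zero_le_one] at this
  have hVi : IntegrableOn V (Ioo 0 1) := hVc.integrableOn_Icc.mono_set Ioo_subset_Icc_self
  have hD : IntegrableOn (fun x => u x - V x) (Ioo 0 1) := hu.sub hVi
  have hmul : ∀ {w g : ℝ → ℝ}, IntegrableOn w (Ioo 0 1) → Continuous g →
      IntegrableOn (fun x => w x * g x) (Ioo 0 1) := fun {w g} hw hg => by
    obtain ⟨B, hB⟩ := isCompact_Icc.exists_bound_of_continuousOn (s := Icc (0 : ℝ) 1)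
      hg.continuousOn
    exact hw.mul_bdd (c := B) hg.aestronglyMeasurable
      ((ae_restrict_iff' measurableSet_Ioo).2 (ae_of_all _ fun x hx => hB x ⟨hx.1.le, hx.2.le⟩))
  have hzero : ∀ φ : ℝ → ℝ, ContDiff ℝ ∞ φ → HasCompactSupport φ → tsupport φ ⊆ Ioo 0 1 →
      ∫ x in Ioo (0 : ℝ) 1, (u x - V x) * deriv φ x = 0 := by
    intro φ hφ hc hs
    have hφ' : Continuous (deriv φ) := (contDiff_infty_iff_deriv.1 hφ).2.continuous
    simp_rw [sub_mul]
    rw [integral_sub (hmul hu hφ') (hmul hVi hφ'), h φ hφ hc hs,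
      integral_primitive_mul_deriv hv hφ hs, sub_self]
  -- Du Bois-Reymond argument: `ψ - (∫ ψ) η` has mean zero, hence is the derivative of a test
  -- function and is orthogonal to `u - V`. This forces `u - V` to be the constant `∫ (u - V) η`.
  let η₀ : ContDiffBump (1 / 2 : ℝ) := ⟨1 / 8, 1 / 4, by norm_num, by norm_num⟩
  let η : ℝ → ℝ := η₀.normed volume
  have hη : ContDiff ℝ ∞ η := η₀.contDiff_normed
  have hηc : HasCompactSupport η := η₀.hasCompactSupport_normed
  have hηs : tsupport η ⊆ Ioo 0 1 := by
    rw [show tsupport η = _ from η₀.tsupport_normed_eq]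
    intro x hx
    rw [Metric.mem_closedBall, Real.dist_eq, abs_le] at hx
    constructor
    · have := hx.1; simp only [η₀] at this; linarith
    · have := hx.2; simp only [η₀] at this; linarith
  have hη1 : ∫ x, η x = 1 := η₀.integral_normed
  set C := ∫ x in Ioo (0 : ℝ) 1, (u x - V x) * η x with hC
  refine ⟨C, ?_⟩
  have key : ∀ᵐ x, x ∈ Ioo (0 : ℝ) 1 → u x - V x - C = 0 := by
    have hDC : IntegrableOn (fun x => u x - V x - C) (Ioo 0 1) :=
      hD.sub (integrableOn_const (by simp))
    refine isOpen_Ioo.ae_eq_zero_of_integral_contDiff_smul_eq_zero hDC.locallyIntegrableOn ?_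
    intro ψ hψ hψc hψs
    have hψi : Integrable ψ := hψ.continuous.integrable_of_hasCompactSupport hψc
    have hηi : Integrable η := hη.continuous.integrable_of_hasCompactSupport hηc
    set m := ∫ x, ψ x with hm
    obtain ⟨φ, hφ, hφc, hφs, hφd⟩ := exists_primitive_of_integral_eq_zero
      (ψ := fun x => ψ x - m * η x) (hψ.sub (contDiff_const.mul hη))
      (hψc.sub hηc.mul_left)
      ((tsupport_sub _ _).trans (union_subset hψs ((tsupport_mul_subset_right).trans hηs)))
      (by rw [integral_sub hψi (hηi.const_mul m), integral_const_mul, hη1]; simp [hm])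
    have h1 := hzero φ hφ hφc hφs
    rw [hφd] at h1
    rw [← setIntegral_eq_integral_of_forall_compl_eq_zero (s := Ioo (0 : ℝ) 1)
      (fun x hx => by rw [eq_zero_of_tsupport_subset_Ioo hψs hx, zero_smul])]
    have h2 : ∫ x in Ioo (0 : ℝ) 1, ψ x = m :=
      setIntegral_eq_integral_of_forall_compl_eq_zero
        fun x hx => eq_zero_of_tsupport_subset_Ioo hψs hx
    have h3 : ∫ x in Ioo (0 : ℝ) 1, (u x - V x) * (ψ x - m * η x)
        = (∫ x in Ioo (0 : ℝ) 1, (u x - V x) * ψ x) - m * C := by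
      rw [hC, ← integral_const_mul, ← integral_sub (hmul hD hψ.continuous)
        ((hmul hD hη.continuous).const_mul m)]
      exact integral_congr_ae (ae_of_all _ fun x => by simp only; ring)
    have h4 : ∫ x in Ioo (0 : ℝ) 1, ψ x • (u x - V x - C)
        = (∫ x in Ioo (0 : ℝ) 1, (u x - V x) * ψ x) - C * m := by
      rw [← h2, ← integral_const_mul, ← integral_sub (hmul hD hψ.continuous)
        (hψi.integrableOn.const_mul C)]
      exact integral_congr_ae (ae_of_all _ fun x => by simp only [smul_eq_mul]; ring)
    rw [h4]
    linarith
  filter_upwards [key] with x hx hx'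
  linarith [hx hx']

/-- Two weak derivatives make `a` a.e. a double primitive, and continuity upgrades this to equality
on [0,1]. Truncating `a₂` to (0,1) lets the primitives be defined on the whole line. -/
lemma TargetSystem.MemH2.exists_contDiff_extension {a : ℝ → ℝ} (h : MemH2 a)
    (ha : ContinuousOn a (Icc 0 1)) : ∃ A : ℝ → ℝ, ContDiff ℝ 1 A ∧ EqOn a A (Icc 0 1) := by
  obtain ⟨a₁, a₂, hw₁, hw₂, hm, hm₁, hm₂⟩ := h
  have hi : IntegrableOn a (Ioo 0 1) := hm.integrable (by norm_num)
  have hi₁ : IntegrableOn a₁ (Ioo 0 1) := hm₁.integrable (by norm_num)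
  have hi₂ : IntegrableOn a₂ (Ioo 0 1) := hm₂.integrable (by norm_num)
  obtain ⟨C₀, hC₀⟩ := hw₁.ae_eq_primitive hi hi₁
  obtain ⟨C₁, hC₁⟩ := hw₂.ae_eq_primitive hi₁ hi₂
  have hind : Integrable ((Ioo (0 : ℝ) 1).indicator a₂) :=
    (integrable_indicator_iff measurableSet_Ioo).2 hi₂
  set b : ℝ → ℝ := fun x => C₁ + ∫ y in (0 : ℝ)..x, (Ioo (0 : ℝ) 1).indicator a₂ y
  have hb : Continuous b :=
    continuous_const.add (intervalIntegral.continuous_primitive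
      (fun _ _ => hind.intervalIntegrable) 0)
  have hprim : ∀ {v v' : ℝ → ℝ}, (∀ᵐ x, x ∈ Ioo (0 : ℝ) 1 → v x = v' x) →
      ∀ x ∈ Ioo (0 : ℝ) 1, ∫ y in (0 : ℝ)..x, v y = ∫ y in (0 : ℝ)..x, v' y := by
    intro v v' hvv x hx
    refine intervalIntegral.integral_congr_ae ?_
    filter_upwards [hvv] with y hy hyx
    rw [uIoc_of_le hx.1.le] at hyx
    exact hy ⟨hyx.1, hyx.2.trans_lt hx.2⟩
  have h₁ : ∀ᵐ x, x ∈ Ioo (0 : ℝ) 1 → a₁ x = b x := by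
    filter_upwards [hC₁] with x hx hx'
    rw [hx hx', hprim (v := a₂) (v' := (Ioo (0 : ℝ) 1).indicator a₂) _ x hx']
    exact ae_of_all _ fun y hy => (indicator_of_mem hy _).symm
  set A : ℝ → ℝ := fun x => C₀ + ∫ y in (0 : ℝ)..x, b y
  have hAd : ∀ x, HasDerivAt A (b x) x := fun x =>
    (hb.integral_hasStrictDerivAt 0 x).hasDerivAt.const_add C₀
  have hA : ContDiff ℝ 1 A := by
    rw [contDiff_one_iff_deriv]
    exact ⟨fun x => (hAd x).differentiableAt,
      by rwa [show deriv A = b from funext fun x => (hAd x).deriv]⟩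
  refine ⟨A, hA, ?_⟩
  have hae : a =ᵐ[volume.restrict (Ioo 0 1)] A := by
    refine (ae_restrict_iff' measurableSet_Ioo).2 ?_
    filter_upwards [hC₀] with x hx hx'
    rw [hx hx', hprim h₁ x hx']
  have hIoo : EqOn a A (Ioo 0 1) :=
    Measure.eqOn_open_of_ae_eq hae isOpen_Ioo (ha.mono Ioo_subset_Icc_self)
      hA.continuous.continuousOn
  exact hIoo.of_subset_closure ha hA.continuous.continuousOn Ioo_subset_Icc_self
    (by rw [closure_Ioo zero_ne_one])

/-- `A` may vanish outside [0,1], so the derivative of `1 / A` is extended by its end values and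
integrated. -/
lemma exists_contDiff_inv_extension {A : ℝ → ℝ} (hA : ContDiff ℝ 1 A)
    (hpos : ∀ x ∈ Icc (0 : ℝ) 1, 0 < A x) :
    ∃ r : ℝ → ℝ, ContDiff ℝ 1 r ∧ ∀ x ∈ Icc (0 : ℝ) 1, r x = (A x)⁻¹ := by
  have hA' : Continuous (deriv A) := hA.continuous_deriv_one
  let q : ℝ → ℝ := IccExtend zero_le_one
    (fun x : Icc (0 : ℝ) 1 => -deriv A x / A x ^ 2)
  have hq : Continuous q := by
    refine Continuous.Icc_extend' (Continuous.div ?_ ?_ fun x => ?_)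
    · exact (hA'.comp continuous_subtype_val).neg
    · exact (hA.continuous.comp continuous_subtype_val).pow 2
    · exact pow_ne_zero 2 (hpos x x.2).ne'
  let r : ℝ → ℝ := fun x => (A 0)⁻¹ + ∫ y in (0 : ℝ)..x, q y
  have hrd : ∀ x, HasDerivAt r (q x) x := fun x =>
    (hq.integral_hasStrictDerivAt 0 x).hasDerivAt.const_add _
  refine ⟨r, ?_, fun x hx => ?_⟩
  · rw [contDiff_one_iff_deriv]
    exact ⟨fun x => (hrd x).differentiableAt,
      by rwa [show deriv r = q from funext fun x => (hrd x).deriv]⟩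
  · have := intervalIntegral.integral_eq_sub_of_hasDerivAt (a := 0) (b := x)
      (f := fun y => (A y)⁻¹) (f' := q) (fun y hy => ?_) (hq.intervalIntegrable _ _)
    · simp only [r, this]; ring
    · rw [uIcc_of_le hx.1] at hy
      have hy' : y ∈ Icc (0 : ℝ) 1 := ⟨hy.1, hy.2.trans hx.2⟩
      have := ((hA.differentiable one_ne_zero) y).hasDerivAt.inv (hpos y hy').ne'
      rwa [show q y = _ from IccExtend_of_mem zero_le_one _ hy']

/-! ### Detecting the sign by mollification -/

/-- An integrable function on `(0,1)` whose integral against every nonnegative smooth function with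
compact support is nonpositive is nonpositive a.e. -/
lemma ae_nonpos_of_forall_integral_mul_nonpos {v : ℝ → ℝ} (hv : IntegrableOn v (Ioo 0 1))
    (h : ∀ g : ℝ → ℝ, ContDiff ℝ ∞ g → tsupport g ⊆ Ioo 0 1 → (∀ x, 0 ≤ g x) →
      ∫ x in Ioo (0 : ℝ) 1, v x * g x ≤ 0) :
    ∀ᵐ x ∂volume.restrict (Ioo (0 : ℝ) 1), v x ≤ 0 := by
  have hV : Integrable ((Ioo (0 : ℝ) 1).indicator v) :=
    (integrable_indicator_iff measurableSet_Ioo).2 hv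
  let b : ℕ → ContDiffBump (0 : ℝ) := fun n =>
    ⟨1 / (n + 1) / 2, 1 / (n + 1), by positivity, half_lt_self (by positivity)⟩
  have hb : Tendsto (fun n => (b n).rOut) atTop (𝓝 0) := tendsto_one_div_add_atTop_nhds_zero_nat
  have hae := ContDiffBump.ae_convolution_tendsto_right_of_locallyIntegrable (μ := volume)
    (K := 2) hb (Eventually.of_forall fun n => by simp only [b]; linarith) hV.locallyIntegrable
  refine (ae_restrict_iff' measurableSet_Ioo).2 ?_
  filter_upwards [hae] with x hx hx01
  rw [indicator_of_mem hx01] at hx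
  refine le_of_tendsto hx ?_
  have hpos : 0 < min x (1 - x) := lt_min hx01.1 (sub_pos.2 hx01.2)
  -- Once the radius is below the distance from `x` to the boundary, the kernel centred at `x` is an
  -- admissible test function.
  filter_upwards [hb.eventually (gt_mem_nhds hpos)] with n hn
  have hn1 := hn.trans_le (min_le_left _ _)
  have hn2 := hn.trans_le (min_le_right _ _)
  let g : ℝ → ℝ := fun t => (b n).normed volume (x - t)
  have hg : ContDiff ℝ ∞ g := (b n).contDiff_normed.comp (contDiff_const.sub contDiff_id)
  have hgs : tsupport g ⊆ Ioo 0 1 := by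
    have : tsupport g ⊆ Metric.closedBall x (b n).rOut := by
      refine closure_minimal (fun t ht => ?_) Metric.isClosed_closedBall
      have h1 : x - t ∈ Function.support ((b n).normed volume) := ht
      rw [(b n).support_normed_eq, mem_ball_zero_iff, Real.norm_eq_abs] at h1
      rw [Metric.mem_closedBall, Real.dist_eq, abs_sub_comm]
      exact h1.le
    refine this.trans fun t ht => ?_
    rw [Metric.mem_closedBall, Real.dist_eq, abs_le] at ht
    constructor <;> linarith [ht.1, ht.2]
  have h2 := h g hg hgs fun t => (b n).nonneg_normed _
  rw [convolution_eq_swap]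
  rw [← integral_indicator measurableSet_Ioo] at h2
  refine (le_of_eq (integral_congr_ae (ae_of_all _ fun t => ?_))).trans h2
  by_cases ht : t ∈ Ioo (0 : ℝ) 1
  · simp [ht, g, mul_comm]
  · simp [ht]

/-! ### Backward implicit Euler scheme for test functions -/

namespace TargetSystem

/-- The pairing `∫₀¹ u g` of an `L²` function with a function. -/
noncomputable def pairing (u : L2) (g : ℝ → ℝ) : ℝ := ∫ x in Ioo (0 : ℝ) 1, u x * g x

lemma memLp_of_continuous {g : ℝ → ℝ} (hg : Continuous g) : MemLp g 2 μ := by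
  obtain ⟨B, hB⟩ := isCompact_Icc.exists_bound_of_continuousOn (s := Icc (0 : ℝ) 1)
    hg.continuousOn
  exact MemLp.of_bound hg.aestronglyMeasurable B
    ((ae_restrict_iff' measurableSet_Ioo).2 (ae_of_all _ fun x hx => hB x ⟨hx.1.le, hx.2.le⟩))

lemma pairing_eq_inner (u : L2) {g : ℝ → ℝ} (hg : MemLp g 2 μ) :
    pairing u g = inner ℝ u hg.toLp := by
  rw [L2.inner_def]
  refine integral_congr_ae ?_
  filter_upwards [hg.coeFn_toLp] with x hx
  simp [hx, mul_comm]

lemma pairing_sub_left (u u' : L2) {g : ℝ → ℝ} (hg : Continuous g) :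
    pairing (u - u') g = pairing u g - pairing u' g := by
  simp only [pairing_eq_inner _ (memLp_of_continuous hg), inner_sub_left]

lemma pairing_congr (u : L2) {g g' : ℝ → ℝ} (h : ∀ x ∈ Ioo (0 : ℝ) 1, g x = g' x) :
    pairing u g = pairing u g' :=
  setIntegral_congr_fun measurableSet_Ioo fun x hx => by simp only [h x hx]

lemma pairing_mul_sub (u : L2) {g g' : ℝ → ℝ} (c : ℝ) (hg : Continuous g) (hg' : Continuous g') :
    pairing u (fun x => c * (g x - g' x)) = c * (pairing u g - pairing u g') := by
  have hi : ∀ {g : ℝ → ℝ}, Continuous g → Integrable (fun x => u x * g x) μ := fun hg =>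
    (Lp.memLp u).integrable_mul (memLp_of_continuous hg)
  rw [pairing, pairing, pairing, ← integral_sub (hi hg) (hi hg'), ← integral_const_mul]
  exact integral_congr_ae (ae_of_all _ fun x => by simp only; ring)

lemma abs_pairing_le (u : L2) {g : ℝ → ℝ} (hg : Continuous g) {L : ℝ} (hL : 0 ≤ L)
    (hgL : ∀ x ∈ Ioo (0 : ℝ) 1, |g x| ≤ L) : |pairing u g| ≤ ‖u‖ * L := by
  have hm := memLp_of_continuous hg
  rw [pairing_eq_inner u hm]
  refine (abs_real_inner_le_norm _ _).trans (mul_le_mul_of_nonneg_left ?_ (norm_nonneg _))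
  refine (Lp.norm_le_of_ae_bound hL (C := L) ?_).trans ?_
  · filter_upwards [hm.coeFn_toLp, ae_restrict_mem measurableSet_Ioo] with x hx hx'
    rw [hx]
    exact hgL x hx'
  · simp [measureUnivNNReal, μ]

lemma continuousOn_pairing {v : ℝ → L2} {s : Set ℝ} (hv : ContinuousOn v s) {g : ℝ → ℝ}
    (hg : Continuous g) : ContinuousOn (fun t => pairing (v t) g) s := by
  simp only [pairing_eq_inner _ (memLp_of_continuous hg)]
  exact hv.inner continuousOn_const

/-- Positivity for the evolution inequality `v_t ≤ (a v_x)_x - σ v`, in its form tested with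
nonnegative functions, by an implicit Euler scheme for the test functions. -/
lemma pairing_nonpos_of_evolution_le {r : ℝ → ℝ} (hr : Continuous r)
    (hrpos : ∀ x ∈ Icc (0 : ℝ) 1, 0 < r x) {σ T : ℝ} (hσ : 0 < σ) (hT : 0 < T) {v : ℝ → L2}
    (hv : ContinuousOn v (Icc 0 T))
    (hv0 : ∀ φ : ℝ → ℝ, (∀ x ∈ Icc (0 : ℝ) 1, 0 ≤ φ x) → pairing (v 0) φ ≤ 0)
    (hstep : ∀ φ p q : ℝ → ℝ, IsFluxPair r φ p q → φ 0 = 0 → φ 1 = 0 →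
      (∀ x ∈ Icc (0 : ℝ) 1, 0 ≤ φ x) → ∀ s t, 0 ≤ s → s ≤ t → t ≤ T →
      pairing (v t) φ ≤ pairing (v s) φ + ∫ τ in s..t, pairing (v τ) (fun x => q x - σ * φ x))
    {g pg qg : ℝ → ℝ} (hg : IsFluxPair r g pg qg) (hg0 : g 0 = 0) (hg1 : g 1 = 0)
    (hgpos : ∀ x ∈ Icc (0 : ℝ) 1, 0 ≤ g x) : pairing (v T) g ≤ 0 := by
  obtain ⟨L, hL⟩ := isCompact_Icc.exists_bound_of_continuousOn (s := Icc (0 : ℝ) 1)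
    (hg.continuous_deriv.sub (hg.continuous_fst.const_smul σ)).continuousOn
  have hL0 : 0 ≤ L := (norm_nonneg _).trans (hL 0 (by simp))
  have huc := isCompact_Icc.uniformContinuousOn_of_continuous hv
  have main : ∀ ε > 0, pairing (v T) g ≤ T * L * ε := by
    intro ε hε
    obtain ⟨δ, hδ, hδv⟩ := Metric.uniformContinuousOn_iff.1 huc ε hε
    obtain ⟨n, hn⟩ := exists_nat_gt (T / δ)
    have hn0 : (0 : ℝ) < n := (div_pos hT hδ).trans hn
    set h := T / n with hh
    have hh0 : 0 < h := div_pos hT hn0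
    have hhδ : h < δ := by
      rw [div_lt_iff₀ hδ] at hn
      rw [hh, div_lt_iff₀ hn0]
      linarith
    have hnh : n * h = T := by rw [hh]; field_simp
    have ind : ∀ m : ℕ, m ≤ n → ∃ φ p q, IsFluxPair r φ p q ∧ φ 0 = 0 ∧ φ 1 = 0 ∧
        (∀ x ∈ Icc (0 : ℝ) 1, 0 ≤ φ x) ∧ (∀ x ∈ Icc (0 : ℝ) 1, |q x - σ * φ x| ≤ L) ∧
        pairing (v T) g ≤ pairing (v (T - m * h)) φ + m * h * (L * ε) := by
      intro m
      induction m with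
      | zero =>
        intro _
        exact ⟨g, pg, qg, hg, hg0, hg1, hgpos, hL, by simp⟩
      | succ m ih =>
        intro hm
        obtain ⟨ψ, pψ, qψ, hψ, hψ0, hψ1, hψpos, hψL, hψle⟩ := ih (by omega)
        -- `φ - h ℓφ = ψ`, divided by `h`, is `c φ - (a φ')' = ψ / h`.
        set c := σ + 1 / h with hc
        have hc0 : 0 < c := by positivity
        have hψc := hψ.continuous_fst
        obtain ⟨φ, p, q, hφ, hφ0, hφ1, hφq⟩ := exists_isFluxPair_boundary hr
          (G := fun x => ψ x / h) (hψc.div_const h) hrpos hc0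
        have hφpos : ∀ x ∈ Icc (0 : ℝ) 1, 0 ≤ φ x := by
          intro x hx
          have := hφ.neg.le_of_forall_le hrpos (by simpa using hφ0) (by simpa using hφ1) hc0
            le_rfl (fun y hy => ?_) x hx
          · linarith
          · have hy' : y ∈ Icc (0 : ℝ) 1 := ⟨hy.1.le, hy.2.le⟩
            have h1 : 0 ≤ ψ y / h := div_nonneg (hψpos y hy') hh0.le
            rw [hφq y hy']
            linarith
        -- The increment `e = φ - ψ` solves `c e - (a e')' = ℓψ`, and `|ℓψ| ≤ L`. As `ℓφ = e / h`
        -- and `1 / c ≤ h`, the bound `L` passes to `ℓφ`.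
        have he : ∀ x ∈ Icc (0 : ℝ) 1, |φ x - 1 * ψ x| ≤ L / c := by
          refine (hφ.sub_const_mul hψ 1).abs_le_of_forall_abs_le hrpos (by simp [hφ0, hψ0])
            (by simp [hφ1, hψ1]) hc0 (by positivity) fun y hy => ?_
          have hy' : y ∈ Icc (0 : ℝ) 1 := ⟨hy.1.le, hy.2.le⟩
          rw [mul_div_cancel₀ _ hc0.ne', hφq y hy']
          convert hψL y hy' using 2
          rw [hc]
          ring
        have hℓ : ∀ x ∈ Icc (0 : ℝ) 1, q x - σ * φ x = 1 / h * (φ x - ψ x) := by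
          intro x hx
          rw [hφq x hx, hc]
          ring
        have hℓL : ∀ x ∈ Icc (0 : ℝ) 1, |q x - σ * φ x| ≤ L := by
          intro x hx
          have h1 := he x hx
          rw [one_mul] at h1
          rw [hℓ x hx, abs_mul, abs_of_pos (one_div_pos.2 hh0)]
          have h2 : L / c ≤ L * h := by
            rw [div_le_iff₀ hc0, hc]
            have h3 : L * h * (σ + 1 / h) = L * h * σ + L := by field_simp
            have h4 : 0 ≤ L * h * σ := by positivity
            linarith
          rw [one_div_mul_eq_div, div_le_iff₀ hh0]
          exact h1.trans h2
        refine ⟨φ, p, q, hφ, hφ0, hφ1, hφpos, hℓL, hψle.trans ?_⟩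
        push_cast at hm ⊢
        set t := T - m * h with ht
        have hs : T - (m + 1) * h = t - h := by rw [ht]; ring
        rw [hs]
        have hs0 : 0 ≤ t - h := by
          have : ((m + 1 : ℕ) : ℝ) * h ≤ n * h :=
            mul_le_mul_of_nonneg_right (by exact_mod_cast hm) hh0.le
          push_cast at this
          rw [← hs]
          linarith
        have htT : t ≤ T := by
          have : 0 ≤ m * h := by positivity
          linarith
        have hℓc : Continuous fun x => q x - σ * φ x :=
          hφ.continuous_deriv.sub (hφ.continuous_fst.const_smul σ)
        have hst := hstep φ p q hφ hφ0 hφ1 hφpos (t - h) t hs0 (by linarith) htT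
        have hsub : Icc (t - h) t ⊆ Icc 0 T := Icc_subset_Icc hs0 htT
        -- Freezing `v` at time `t` costs `h L ε`, and `h ⟨v(t), ℓφ⟩ = ⟨v(t), φ⟩ - ⟨v(t), ψ⟩`. In
        -- `hst` the terms `⟨v(t), φ⟩` then cancel, leaving `⟨v(t), ψ⟩ ≤ ⟨v(t - h), φ⟩ + h L ε`.
        have hint : ∫ τ in (t - h)..t, pairing (v τ) (fun x => q x - σ * φ x)
            ≤ ∫ _ in (t - h)..t, (pairing (v t) (fun x => q x - σ * φ x) + ε * L) := by
          refine intervalIntegral.integral_mono_on (by linarith)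
            (ContinuousOn.intervalIntegrable_of_Icc (by linarith)
              (continuousOn_pairing (hv.mono hsub) hℓc)) (by simp) fun τ hτ => ?_
          have h1 := abs_pairing_le (v τ - v t) hℓc hL0 fun x hx => hℓL x ⟨hx.1.le, hx.2.le⟩
          rw [pairing_sub_left _ _ hℓc] at h1
          have h2 : ‖v τ - v t‖ ≤ ε := by
            rw [← dist_eq_norm]
            refine (hδv τ (hsub hτ) t (hsub ⟨by linarith, le_rfl⟩) ?_).le
            rw [Real.dist_eq, abs_lt]
            constructor <;> linarith [hτ.1, hτ.2]
          have h3 := mul_le_mul_of_nonneg_right h2 hL0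
          linarith [le_abs_self (pairing (v τ) (fun x => q x - σ * φ x)
            - pairing (v t) (fun x => q x - σ * φ x))]
        rw [intervalIntegral.integral_const, smul_eq_mul, sub_sub_cancel,
          pairing_congr (v t) (g' := fun x => 1 / h * (φ x - ψ x))
            (fun x hx => hℓ x ⟨hx.1.le, hx.2.le⟩),
          pairing_mul_sub _ _ hφ.continuous_fst hψc] at hint
        have h5 : h * (1 / h * (pairing (v t) φ - pairing (v t) ψ) + ε * L)
            = pairing (v t) φ - pairing (v t) ψ + h * (L * ε) := by
          field_simp
        rw [h5] at hint
        linarith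
    obtain ⟨φ, p, q, -, -, -, hφpos, -, hle⟩ := ind n le_rfl
    rw [hnh, sub_self] at hle
    linarith [hv0 φ hφpos]
  by_contra! hcon
  have h1 := main (pairing (v T) g / (2 * (T * L + 1))) (by positivity)
  have h2 : T * L * (pairing (v T) g / (2 * (T * L + 1)))
      = pairing (v T) g * (T * L / (2 * (T * L + 1))) := by ring
  have h3 : T * L / (2 * (T * L + 1)) < 1 := by
    have : 0 ≤ T * L := by positivity
    rw [div_lt_one (by positivity)]
    linarith
  rw [h2] at h1
  nlinarith

end TargetSystem

/-! ### Comparison of a weak solution with a constant -/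

namespace TargetSystem

/-- The constant `k` as an element of `L²(0,1)`. -/
noncomputable def constL2 (k : ℝ) : L2 := (memLp_const (μ := μ) (p := 2) k).toLp

lemma coeFn_constL2 (k : ℝ) : constL2 k =ᵐ[μ] fun _ => k := MemLp.coeFn_toLp _

lemma pairing_constL2 (k : ℝ) (g : ℝ → ℝ) :
    pairing (constL2 k) g = k * ∫ x in Ioo (0 : ℝ) 1, g x := by
  rw [← integral_const_mul]
  refine integral_congr_ae ?_
  filter_upwards [coeFn_constL2 k] with x hx
  rw [hx]

lemma pairing_neg_left (u : L2) (g : ℝ → ℝ) : pairing (-u) g = -pairing u g := by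
  rw [pairing, pairing, ← integral_neg]
  refine integral_congr_ae ?_
  filter_upwards [Lp.coeFn_neg u] with x hx
  rw [hx, Pi.neg_apply, neg_mul]

lemma IsWeakSolution.neg {a : ℝ → ℝ} {σ T₀ : ℝ} {f : ℝ × ℝ → ℝ} {d₀ d₁ : ℝ → ℝ} {w : ℝ → L2}
    (hw : IsWeakSolution a σ T₀ f d₀ d₁ w) :
    IsWeakSolution a σ T₀ (fun x => -f x) (fun t => -d₀ t) (fun t => -d₁ t) (fun t => -w t) where
  continuousOn := hw.continuousOn.neg
  initial := by simp [hw.initial]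
  weak_eq φ hφ h0 h1 t ht := by
    have hneg : ∀ (u : L2) (g : ℝ → ℝ), ∫ x in Ioo (0 : ℝ) 1, (-u : L2) x * g x
        = -∫ x in Ioo (0 : ℝ) 1, u x * g x := pairing_neg_left
    have h := hw.weak_eq φ hφ h0 h1 t ht
    have h2 : ∀ s, a 0 * deriv φ 0 * -d₀ s - a 1 * deriv φ 1 * -d₁ s
        = -(a 0 * deriv φ 0 * d₀ s - a 1 * deriv φ 1 * d₁ s) := fun s => by ring
    simp only [hneg, neg_mul, integral_neg, intervalIntegral.integral_neg, h2, h]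
    ring

lemma integral_Q_const_mul_fst (t k : ℝ) (ht : 0 ≤ t) (φ : ℝ → ℝ) :
    ∫ p in Q t, k * φ p.1 = t * (k * ∫ x in Ioo (0 : ℝ) 1, φ x) := by
  have := setIntegral_prod_mul (μ := (volume : Measure ℝ)) (ν := (volume : Measure ℝ))
    (fun x => k * φ x) (fun _ => (1 : ℝ)) (Ioo (0 : ℝ) 1) (Ioo (0 : ℝ) t)
  simp only [mul_one] at this
  rw [Q, Measure.volume_eq_prod, this, integral_const_mul]
  simp [ht, mul_comm]

section Step

variable {a A r : ℝ → ℝ} {σ T₀ T k : ℝ} {f : ℝ × ℝ → ℝ} {d₀ d₁ : ℝ → ℝ} {w : ℝ → L2}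

lemma integrableOn_Q_mul (hf : IntegrableOn f (Q T)) {φ : ℝ → ℝ} (hφ : Continuous φ) :
    IntegrableOn (fun p => f p * φ p.1) (Q T) := by
  obtain ⟨B, hB⟩ := isCompact_Icc.exists_bound_of_continuousOn (s := Icc (0 : ℝ) 1)
    hφ.continuousOn
  exact hf.mul_bdd (c := B) (hφ.comp continuous_fst).aestronglyMeasurable
    ((ae_restrict_iff' (measurableSet_Ioo.prod measurableSet_Ioo)).2
      (ae_of_all _ fun p hp => hB p.1 ⟨hp.1.1.le, hp.1.2.le⟩))

/-- The integrand `(k - f) φ` is nonnegative, so its integral grows with the cylinder. -/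
lemma integral_source_sub_le (hf : IntegrableOn f (Q T))
    (hfk : ∀ᵐ p ∂volume.restrict (Q T), f p ≤ k) {φ : ℝ → ℝ} (hφ : Continuous φ)
    (hφpos : ∀ x ∈ Icc (0 : ℝ) 1, 0 ≤ φ x) {s t : ℝ} (hs : 0 ≤ s) (hst : s ≤ t) (htT : t ≤ T) :
    (∫ p in Q t, f p * φ p.1) - ∫ p in Q s, f p * φ p.1
      ≤ (t - s) * (k * ∫ x in Ioo (0 : ℝ) 1, φ x) := by
  have hQ : ∀ {s t}, s ≤ t → Q s ⊆ Q t := fun h =>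
    prod_mono subset_rfl (Ioo_subset_Ioo_right h)
  have hQm : ∀ t, MeasurableSet (Q t) := fun t => measurableSet_Ioo.prod measurableSet_Ioo
  have hi := integrableOn_Q_mul hf hφ
  have hk : IntegrableOn (fun p : ℝ × ℝ => k * φ p.1) (Q T) := by
    refine integrableOn_Q_mul (f := fun _ => k) (integrableOn_const ?_) hφ
    rw [Q, Measure.volume_eq_prod, Measure.prod_prod]
    simp
  have hmono := setIntegral_mono_set (μ := volume) (s := Q s) (t := Q t)
    (f := fun p => k * φ p.1 - f p * φ p.1) ((hk.sub hi).mono_set (hQ htT)) ?_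
    (hQ hst).eventuallyLE
  · rw [integral_sub (hk.mono_set (hQ (hst.trans htT))) (hi.mono_set (hQ (hst.trans htT))),
      integral_sub (hk.mono_set (hQ htT)) (hi.mono_set (hQ htT)),
      integral_Q_const_mul_fst s k hs, integral_Q_const_mul_fst t k (hs.trans hst)] at hmono
    linarith
  · filter_upwards [ae_restrict_of_ae_restrict_of_subset (hQ htT) hfk,
      ae_restrict_mem (hQm t)] with p hp hpQ
    have := mul_le_mul_of_nonneg_right hp (hφpos p.1 ⟨hpQ.1.1.le, hpQ.1.2.le⟩)
    simp only [Pi.zero_apply]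
    linarith

/-- Since `φ ≥ 0` vanishes at both ends, its flux satisfies `p 0 ≥ 0 ≥ p 1`, so the boundary terms
are at most `(p 0 - p 1) k`. With the source bound `σ k ∫ φ`, this exactly cancels the contribution
`k ∫ ℓφ` of the constant. -/
lemma IsWeakSolution.evolution_le (hw : IsWeakSolution a σ T₀ f d₀ d₁ w)
    (hr : ContDiff ℝ 1 r) (har : ∀ x ∈ Icc (0 : ℝ) 1, a x * r x = 1)
    (hrpos : ∀ x ∈ Icc (0 : ℝ) 1, 0 < r x)
    (hT : T ∈ Ioo 0 T₀) (hf : IntegrableOn f (Q T)) (hd₀ : ContinuousOn d₀ (Ici 0))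
    (hd₁ : ContinuousOn d₁ (Ici 0)) (hfk : ∀ᵐ p ∂volume.restrict (Q T), f p ≤ σ * k)
    (hd₀k : ∀ᵐ t ∂volume.restrict (Ioo 0 T), d₀ t ≤ k)
    (hd₁k : ∀ᵐ t ∂volume.restrict (Ioo 0 T), d₁ t ≤ k)
    {φ p q : ℝ → ℝ} (h : IsFluxPair r φ p q) (h0 : φ 0 = 0) (h1 : φ 1 = 0)
    (hφpos : ∀ x ∈ Icc (0 : ℝ) 1, 0 ≤ φ x) {s t : ℝ} (hs : 0 ≤ s) (hst : s ≤ t) (htT : t ≤ T) :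
    pairing (w t - constL2 k) φ ≤ pairing (w s - constL2 k) φ
      + ∫ τ in s..t, pairing (w τ - constL2 k) (fun x => q x - σ * φ x) := by
  have hφc := h.continuous_fst
  have hℓc : Continuous fun x => q x - σ * φ x := h.continuous_deriv.sub (hφc.const_smul σ)
  have hap : ∀ x ∈ Icc (0 : ℝ) 1, a x * deriv φ x = p x := fun x hx => by
    rw [(h.hasDerivAt_fst x).deriv, ← mul_assoc, har x hx, one_mul]
  have hderiv : ∀ x ∈ Ioo (0 : ℝ) 1, deriv (fun y => a y * deriv φ y) x = q x := fun x hx => by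
    rw [← (h.hasDerivAt_snd x).deriv]
    refine Filter.EventuallyEq.deriv_eq ?_
    filter_upwards [Icc_mem_nhds hx.1 hx.2] with y hy
    exact hap y hy
  have hp0 : 0 ≤ p 0 := by
    have hlim := (hasDerivWithinAt_iff_tendsto_slope' (s := Ioi (0 : ℝ)) (by simp)).1
      (h.hasDerivAt_fst 0).hasDerivWithinAt
    have : 0 ≤ r 0 * p 0 := by
      refine ge_of_tendsto hlim ?_
      filter_upwards [Ioo_mem_nhdsGT (zero_lt_one (α := ℝ))] with x hx
      rw [slope_def_field, h0]
      exact div_nonneg (by simpa using hφpos x ⟨hx.1.le, hx.2.le⟩) (by linarith [hx.1])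
    exact nonneg_of_mul_nonneg_right this (hrpos 0 (by simp))
  have hp1 : p 1 ≤ 0 := by
    have hlim := (hasDerivWithinAt_iff_tendsto_slope' (s := Iio (1 : ℝ)) (by simp)).1
      (h.hasDerivAt_fst 1).hasDerivWithinAt
    have : r 1 * p 1 ≤ 0 := by
      refine le_of_tendsto hlim ?_
      filter_upwards [Ioo_mem_nhdsLT (zero_lt_one (α := ℝ))] with x hx
      rw [slope_def_field, h1]
      exact div_nonpos_of_nonneg_of_nonpos (by simpa using hφpos x ⟨hx.1.le, hx.2.le⟩)
        (by linarith [hx.2])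
    exact nonpos_of_mul_nonpos_right this (hrpos 1 (by simp))
  have hweak : ∀ t ∈ Icc 0 T, pairing (w t) φ
      = (∫ τ in (0 : ℝ)..t, pairing (w τ) (fun x => q x - σ * φ x))
        + (∫ z in Q t, f z * φ z.1) + ∫ τ in (0 : ℝ)..t, (p 0 * d₀ τ - p 1 * d₁ τ) := by
    intro t ht
    have := hw.weak_eq φ (h.contDiff_two hr) h0 h1 t ⟨ht.1, ht.2.trans_lt hT.2⟩
    rw [hap 0 (by simp), hap 1 (by simp)] at this
    rw [pairing, this]
    congr 2
    refine intervalIntegral.integral_congr fun τ _ => ?_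
    exact pairing_congr (w τ) fun x hx => by rw [hderiv x hx]
  have ht0 := hs.trans hst
  have hsT := hst.trans htT
  have hws := hweak s ⟨hs, hsT⟩
  have hwt := hweak t ⟨ht0, htT⟩
  have hBc : ContinuousOn (fun τ => pairing (w τ) (fun x => q x - σ * φ x)) (Ico 0 T₀) :=
    continuousOn_pairing hw.continuousOn hℓc
  have hBi : ∀ {s t}, 0 ≤ s → s ≤ t → t ≤ T →
      IntervalIntegrable (fun τ => pairing (w τ) (fun x => q x - σ * φ x)) volume s t :=
    fun hs hst htT => ContinuousOn.intervalIntegrable_of_Icc hst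
      (hBc.mono fun τ hτ => ⟨hs.trans hτ.1, hτ.2.trans_lt (htT.trans_lt hT.2)⟩)
  have hDc : ContinuousOn (fun τ => p 0 * d₀ τ - p 1 * d₁ τ) (Ici 0) :=
    (hd₀.const_smul (p 0)).sub (hd₁.const_smul (p 1))
  have hDi : ∀ {s t}, 0 ≤ s → s ≤ t →
      IntervalIntegrable (fun τ => p 0 * d₀ τ - p 1 * d₁ τ) volume s t :=
    fun hs hst => ContinuousOn.intervalIntegrable_of_Icc hst
      (hDc.mono fun τ hτ => hs.trans hτ.1)
  have hBadd := intervalIntegral.integral_add_adjacent_intervals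
    (hBi le_rfl hs hsT) (hBi hs hst htT)
  have hDadd := intervalIntegral.integral_add_adjacent_intervals (hDi le_rfl hs) (hDi hs hst)
  have hF := integral_source_sub_le hf hfk hφc hφpos hs hst htT
  have hD : ∫ τ in s..t, (p 0 * d₀ τ - p 1 * d₁ τ) ≤ ∫ _ in s..t, (p 0 * k - p 1 * k) := by
    refine intervalIntegral.integral_mono_ae_restrict hst (hDi hs hst) (by simp) ?_
    rw [Measure.restrict_congr_set Ioo_ae_eq_Icc.symm]
    have hsub : Ioo s t ⊆ Ioo 0 T := Ioo_subset_Ioo hs htT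
    filter_upwards [ae_restrict_of_ae_restrict_of_subset hsub hd₀k,
      ae_restrict_of_ae_restrict_of_subset hsub hd₁k] with τ h0τ h1τ
    have := mul_le_mul_of_nonneg_left h0τ hp0
    have := mul_le_mul_of_nonpos_left h1τ hp1
    linarith
  rw [intervalIntegral.integral_const, smul_eq_mul] at hD
  have hℓint : ∫ x in Ioo (0 : ℝ) 1, (q x - σ * φ x)
      = p 1 - p 0 - σ * ∫ x in Ioo (0 : ℝ) 1, φ x := by
    simp only [← integral_Ioc_eq_integral_Ioo, ← intervalIntegral.integral_of_le zero_le_one]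
    rw [intervalIntegral.integral_sub (h.continuous_deriv.intervalIntegrable _ _)
      ((hφc.const_mul σ).intervalIntegrable _ _), intervalIntegral.integral_const_mul,
      intervalIntegral.integral_eq_sub_of_hasDerivAt (fun x _ => h.hasDerivAt_snd x)
        (h.continuous_deriv.intervalIntegrable _ _)]
  have hBv : ∫ τ in s..t, pairing (w τ - constL2 k) (fun x => q x - σ * φ x)
      = (∫ τ in s..t, pairing (w τ) (fun x => q x - σ * φ x))
        - (t - s) * (k * (p 1 - p 0 - σ * ∫ x in Ioo (0 : ℝ) 1, φ x)) := by
    simp only [pairing_sub_left _ _ hℓc, pairing_constL2, hℓint]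
    rw [intervalIntegral.integral_sub (hBi hs hst htT) (by simp),
      intervalIntegral.integral_const, smul_eq_mul]
  rw [hBv, pairing_sub_left _ _ hφc, pairing_sub_left _ _ hφc]
  linarith

/-- One-sided comparison of a weak solution with a constant. -/
lemma IsWeakSolution.ae_le_const (hw : IsWeakSolution a σ T₀ f d₀ d₁ w) (hσ : 0 < σ)
    (hA : ContDiff ℝ 1 A) (haA : EqOn a A (Icc 0 1)) (hApos : ∀ x ∈ Icc (0 : ℝ) 1, 0 < A x)
    (hT : T ∈ Ioo 0 T₀) (hf : IntegrableOn f (Q T)) (hd₀ : ContinuousOn d₀ (Ici 0))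
    (hd₁ : ContinuousOn d₁ (Ici 0)) (hk : 0 ≤ k)
    (hfk : ∀ᵐ p ∂volume.restrict (Q T), f p ≤ σ * k)
    (hd₀k : ∀ᵐ t ∂volume.restrict (Ioo 0 T), d₀ t ≤ k)
    (hd₁k : ∀ᵐ t ∂volume.restrict (Ioo 0 T), d₁ t ≤ k) :
    ∀ᵐ x ∂μ, w T x ≤ k := by
  obtain ⟨r, hr, hrA⟩ := exists_contDiff_inv_extension hA hApos
  have hrpos : ∀ x ∈ Icc (0 : ℝ) 1, 0 < r x := fun x hx => by
    rw [hrA x hx]; exact inv_pos.2 (hApos x hx)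
  have har : ∀ x ∈ Icc (0 : ℝ) 1, a x * r x = 1 := fun x hx => by
    rw [hrA x hx, haA hx, mul_inv_cancel₀ (hApos x hx).ne']
  have hint : IntegrableOn (w T - constL2 k : L2) (Ioo 0 1) :=
    (Lp.memLp (w T - constL2 k)).integrable (by norm_num)
  have hmain : ∀ᵐ x ∂volume.restrict (Ioo (0 : ℝ) 1), (w T - constL2 k : L2) x ≤ 0 := by
    refine ae_nonpos_of_forall_integral_mul_nonpos hint fun g hg hgs hgpos => ?_
    have hg' : ContDiff ℝ ∞ (deriv g) := (contDiff_infty_iff_deriv.1 hg).2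
    have hpC : ContDiff ℝ 1 fun x => A x * deriv g x := hA.mul (hg'.of_le (by norm_cast))
    have hflux : IsFluxPair r g (fun x => A x * deriv g x)
        (deriv fun x => A x * deriv g x) := by
      refine ⟨fun x => ?_, fun x => ?_, hpC.continuous_deriv_one⟩
      · have hd := ((hg.differentiable (by simp)) x).hasDerivAt
        refine hd.congr_deriv ?_
        -- Outside [0,1] `r` need not invert `A`, but there `g' = 0`.
        by_cases hx : x ∈ Icc (0 : ℝ) 1
        · rw [hrA x hx, inv_mul_cancel_left₀ (hApos x hx).ne']
        · have : deriv g x = 0 := image_eq_zero_of_notMem_tsupport fun hx' =>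
            hx (Ioo_subset_Icc_self (hgs (tsupport_deriv_subset (𝕜 := ℝ) hx')))
          rw [this, mul_zero, mul_zero]
      · exact ((hpC.differentiable one_ne_zero) x).hasDerivAt
    refine pairing_nonpos_of_evolution_le (v := fun t => w t - constL2 k) hr.continuous hrpos hσ
      hT.1 ?_ ?_ ?_ hflux (eq_zero_of_tsupport_subset_Ioo hgs (by simp))
      (eq_zero_of_tsupport_subset_Ioo hgs (by simp)) fun x _ => hgpos x
    · exact (hw.continuousOn.mono fun t ht => ⟨ht.1, ht.2.trans_lt hT.2⟩).sub continuousOn_const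
    · intro φ hφ
      rw [hw.initial, zero_sub, pairing_neg_left, pairing_constL2, neg_nonpos]
      exact mul_nonneg hk (setIntegral_nonneg measurableSet_Ioo fun x hx =>
        hφ x (Ioo_subset_Icc_self hx))
    · intro φ p q h h0 h1 hpos s t hs hst htT
      exact hw.evolution_le hr har hrpos hT hf hd₀ hd₁ hfk hd₀k hd₁k h h0 h1 hpos hs hst htT
  filter_upwards [hmain, Lp.coeFn_sub (w T) (constL2 k), coeFn_constL2 k] with x h1 h2 h3
  rw [h2, Pi.sub_apply, h3] at h1
  linarith

end Step

/-! ### Two-sided bound and conclusion -/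

lemma ae_abs_le_toReal_eLpNorm {α : Type*} [MeasurableSpace α] {ν : Measure α} {g : α → ℝ}
    (h : eLpNorm g ∞ ν ≠ ⊤) : ∀ᵐ x ∂ν, |g x| ≤ (eLpNorm g ∞ ν).toReal := by
  rw [eLpNorm_exponent_top] at h ⊢
  filter_upwards [ae_le_eLpNormEssSup (f := g) (μ := ν)] with x hx
  have := ENNReal.toReal_mono h hx
  simpa using this

end TargetSystem

theorem mainTheorem3
    (a : ℝ → ℝ) (haH2 : TargetSystem.MemH2 a) (ha : ContinuousOn a (Icc 0 1))
    (Λ : ℝ) (hΛ : 1 ≤ Λ) (haΛ : ∀ x ∈ Ioo (0 : ℝ) 1, 1 / Λ ≤ a x ∧ a x ≤ Λ)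
    (σ : ℝ) (hσ : 0 < σ) (T₀ : ℝ) (hT₀ : 0 < T₀)
    (f : ℝ × ℝ → ℝ) (hf : ∀ τ ∈ Ioo 0 T₀, IntegrableOn f (TargetSystem.Q τ))
    (d₀ d₁ : ℝ → ℝ) (hd₀ : ContinuousOn d₀ (Ici 0)) (hd₁ : ContinuousOn d₁ (Ici 0))
    (w : ℝ → TargetSystem.L2) (hw : TargetSystem.IsWeakSolution a σ T₀ f d₀ d₁ w) :
    ∀ t ∈ Ioo 0 T₀,
      eLpNorm (w t) ∞ (volume.restrict (Ioo (0 : ℝ) 1)) ≤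
        ENNReal.ofReal (1 / σ) * eLpNorm f ∞ (volume.restrict (TargetSystem.Q t))
          + eLpNorm d₀ ∞ (volume.restrict (Ioo 0 t))
          + eLpNorm d₁ ∞ (volume.restrict (Ioo 0 t)) := by
  intro t ht
  obtain ⟨A, hA, haA⟩ := haH2.exists_contDiff_extension ha
  have hΛ0 : 0 < 1 / Λ := by positivity
  have hApos : ∀ x ∈ Icc (0 : ℝ) 1, 0 < A x := by
    intro x hx
    have hcl : Icc (0 : ℝ) 1 = closure (Ioo 0 1) := (closure_Ioo zero_ne_one).symm
    have hle : closure (Ioo (0 : ℝ) 1) ⊆ {x | 1 / Λ ≤ A x} :=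
      closure_minimal (fun y hy => by
        have := (haΛ y hy).1
        rwa [haA (Ioo_subset_Icc_self hy)] at this)
        (isClosed_le continuous_const hA.continuous)
    exact hΛ0.trans_le (hle (hcl ▸ hx))
  set F := eLpNorm f ∞ (volume.restrict (TargetSystem.Q t)) with hF
  set D₀ := eLpNorm d₀ ∞ (volume.restrict (Ioo 0 t)) with hD₀
  set D₁ := eLpNorm d₁ ∞ (volume.restrict (Ioo 0 t)) with hD₁
  by_cases hFt : F = ⊤
  · simp [hFt, ENNReal.mul_top, hσ]
  by_cases hD₀t : D₀ = ⊤
  · simp [hD₀t]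
  by_cases hD₁t : D₁ = ⊤
  · simp [hD₁t]
  have hfb := TargetSystem.ae_abs_le_toReal_eLpNorm hFt
  have hd₀b := TargetSystem.ae_abs_le_toReal_eLpNorm hD₀t
  have hd₁b := TargetSystem.ae_abs_le_toReal_eLpNorm hD₁t
  rw [← hF] at hfb
  rw [← hD₀] at hd₀b
  rw [← hD₁] at hd₁b
  set k := 1 / σ * F.toReal + D₀.toReal + D₁.toReal with hk
  have hF0 : 0 ≤ 1 / σ * F.toReal := by positivity
  have hD₀0 : 0 ≤ D₀.toReal := ENNReal.toReal_nonneg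
  have hD₁0 : 0 ≤ D₁.toReal := ENNReal.toReal_nonneg
  have hk0 : 0 ≤ k := by positivity
  -- Only the maximum of the three terms is needed as a barrier; their sum dominates it.
  have hFk : F.toReal ≤ σ * k := by
    have h1 : σ * k = F.toReal + σ * (D₀.toReal + D₁.toReal) := by
      rw [hk]; field_simp; ring
    have h2 : 0 ≤ σ * (D₀.toReal + D₁.toReal) := by positivity
    linarith
  have hD₀k : D₀.toReal ≤ k := by linarith
  have hD₁k : D₁.toReal ≤ k := by linarith
  have hup := hw.ae_le_const hσ hA haA hApos ht (hf t ht) hd₀ hd₁ hk0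
    (hfb.mono fun p hp => (le_abs_self _).trans (hp.trans hFk))
    (hd₀b.mono fun p hp => (le_abs_self _).trans (hp.trans hD₀k))
    (hd₁b.mono fun p hp => (le_abs_self _).trans (hp.trans hD₁k))
  have hlow := hw.neg.ae_le_const hσ hA haA hApos ht (hf t ht).neg hd₀.neg hd₁.neg hk0
    (hfb.mono fun p hp => (neg_le_abs _).trans (hp.trans hFk))
    (hd₀b.mono fun p hp => (neg_le_abs _).trans (hp.trans hD₀k))
    (hd₁b.mono fun p hp => (neg_le_abs _).trans (hp.trans hD₁k))
  have hRHS : ENNReal.ofReal (1 / σ) * F + D₀ + D₁ = ENNReal.ofReal k := by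
    rw [hk, ENNReal.ofReal_add (by positivity) hD₁0, ENNReal.ofReal_add hF0 hD₀0,
      ENNReal.ofReal_mul (by positivity), ENNReal.ofReal_toReal hFt, ENNReal.ofReal_toReal hD₀t,
      ENNReal.ofReal_toReal hD₁t]
  rw [hRHS, eLpNorm_exponent_top]
  refine eLpNormEssSup_le_of_ae_bound ?_
  filter_upwards [hup, hlow, Lp.coeFn_neg (w t)] with x h1 h2 h3
  rw [h3, Pi.neg_apply] at h2
  rw [Real.norm_eq_abs, abs_le]
  exact ⟨by linarith, h1⟩
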